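/- Let $A\in\mathbb R^{n\times n}$, $B\in\mathbb R^{n\times m}$, $C\in\mathbb R^{m\times n}$, $D\in\mathbb R^{m\times m}$ and consider the discrete-time system $$x_{k+1}=Ax_k+Bu_k,\quad x_0=0,\qquad y_k=Cx_k+Du_k ,\qquad k=0,1,2,\dots$$ that is, $y_k=\sum_{i=0}^{k-1}CA^{k-1-i}Bu_i+Du_k$. Assume that $(A,B,C,D)$ is a minimal realisation, i.e. no realisation of the same input-output map $u\mapsto y$ has fewer states. Let $\ell_2^m$ be the Hilbert space of square-summable sequences $(u_k)_{k\ge 0}$ in $\mathbb C^m$, and for $\tau\in\{1,2,\dots\}$ let $\ell_{2,\tau}^m\subseteq\ell_2^m$ be the subspace of sequences with $u_k=0$ for all $k\ge\tau$. Let $\mathbf T^\tau:\ell_{2,\tau}^m\to\ell_{2,\tau}^m$ map $u$ to $(y_0,\dots,y_{\tau-1},0,0,\dots)$, and let $\mathbf T:\operatorname{dom}\mathbf T\subseteq\ell_2^m\to\ell_2^m$ be the operator $u\mapsto y$ with domain $\operatorname{dom}\mathbf T=\{u\in\ell_2^m: y\in\ell_2^m\}$. For a linear, possibly unbounded, operator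 $\mathbf S$ on a Hilbert space define, in $[0,\infty]$, $$\overline{\sigma}(\mathbf S)=\sup_{u\in\operatorname{dom}\mathbf S,\ u\ne0}\frac{\|\mathbf Su\|}{\|u\|},\qquad \underline{\sigma}(\mathbf S)=\inf_{u\in\operatorname{dom}\mathbf S,\ u\ne0}\frac{\|\mathbf Su\|}{\|u\|}.$$ For $P\in\mathbb R^{n\times n}$ and $\gamma,\zeta\ge0$ consider the linear matrix inequalities $$\begin{bmatrix}A^\top PA-P+C^\top C & A^\top PB+C^\top D\\ B^\top PA+D^\top C & B^\top PB+D^\top D-\gamma^2I\end{bmatrix}\preceq0,\tag{1}$$ $$\begin{bmatrix}A^\top PA-P-C^\top C & A^\top PB-C^\top D\\ B^\top PA-D^\top C & B^\top PB-D^\top D+\zeta^2I\end{bmatrix}\preceq0.\tag{2}$$ Then, with infima and suprema taken in $[0,\infty]$ (so that $\inf\emptyset=\infty$ and $\sup\emptyset=0$), the limits below exist in $[0,\infty]$ and: 1. $\lim_{\tau\to\infty}\overline{\sigma}(\mathbf T^\tau)=\inf\{\gamma\ge0:\ \text{(1) holds for some } P=P^\top\succeq0\}$; 2. $\lim_{\tau\to\infty}\underline{\sigma}(\mathbf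 T^\tau)=\sup\{\zeta\ge0:\ \text{(2) holds for some } P=P^\top\succeq0\}$; 3. $\overline{\sigma}(\mathbf T)=\inf\{\gamma\ge0:\ \text{(1) holds for some } P=P^\top\}$; 4. $\underline{\sigma}(\mathbf T)=\sup\{\zeta\ge0:\ \text{(2) holds for some } P=P^\top\}$. -/

import Mathlib

open Filter Topology
open scoped NNReal ENNReal Matrix

noncomputable section

namespace GainLMI

/-- The gain `sup ‖T u‖ / ‖u‖` over nonzero `u` in the domain of a possibly unbounded linear
operator, as an element of `[0, ∞]`. -/
def maxGain {H : Type*} [NormedAddCommGroup H] [InnerProductSpace ℂ H]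
    (T : H →ₗ.[ℂ] H) : ℝ≥0∞ :=
  ⨆ (u : T.domain) (_ : u ≠ 0), ENNReal.ofReal (‖T u‖ / ‖(u : H)‖)

/-- The gain `inf ‖T u‖ / ‖u‖` over nonzero `u` in the domain of a possibly unbounded linear
operator, as an element of `[0, ∞]`. -/
def minGain {H : Type*} [NormedAddCommGroup H] [InnerProductSpace ℂ H]
    (T : H →ₗ.[ℂ] H) : ℝ≥0∞ :=
  ⨅ (u : T.domain) (_ : u ≠ 0), ENNReal.ofReal (‖T u‖ / ‖(u : H)‖)

/-- Real state-space data with `n` states, `m` inputs and `m` outputs. -/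
structure LTI (n m : ℕ) where
  A : Matrix (Fin n) (Fin n) ℝ
  B : Matrix (Fin n) (Fin m) ℝ
  C : Matrix (Fin m) (Fin n) ℝ
  D : Matrix (Fin m) (Fin m) ℝ

/-- Sequences in `ℂ^m`, with the Euclidean norm on `ℂ^m`. -/
abbrev Signal (m : ℕ) : Type := ℕ → EuclideanSpace ℂ (Fin m)

/-- The Hilbert space of square-summable sequences in `ℂ^m`. -/
abbrev EllTwo (m : ℕ) : Type := lp (fun _ : ℕ => EuclideanSpace ℂ (Fin m)) 2

/-- The subspace of those `f ∈ ℓ₂` with `f k = 0` for all `k ≥ τ`. -/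
def ellTwoTrunc (m τ : ℕ) : Submodule ℂ (EllTwo m) where
  carrier := {f | ∀ k, τ ≤ k → f k = 0}
  zero_mem' := fun _ _ => rfl
  add_mem' := fun {f g} hf hg k hk => by
    rw [lp.coeFn_add, Pi.add_apply, hf k hk, hg k hk, add_zero]
  smul_mem' := fun c f hf k hk => by
    rw [lp.coeFn_smul, Pi.smul_apply, hf k hk, smul_zero]

namespace LTI

variable {n m : ℕ} (S : LTI n m)

/-- The state sequence `x_{k+1} = A x_k + B u_k`, `x_0 = 0`. -/
def state (u : Signal m) : ℕ → Fin n → ℂ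
  | 0 => 0
  | k + 1 => S.A.map Complex.ofReal *ᵥ state u k + S.B.map Complex.ofReal *ᵥ (u k).ofLp

/-- The output sequence `y_k = C x_k + D u_k`. -/
def output (u : Signal m) : Signal m := fun k =>
  WithLp.toLp 2
    (S.C.map Complex.ofReal *ᵥ S.state u k + S.D.map Complex.ofReal *ᵥ (u k).ofLp)

theorem state_add (u v : Signal m) (k : ℕ) :
    S.state (u + v) k = S.state u k + S.state v k := by
  induction k with
  | zero => simp [state]
  | succ k ih =>
    simp only [state, ih, Pi.add_apply, WithLp.ofLp_add, Matrix.mulVec_add]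
    abel

theorem state_smul (c : ℂ) (u : Signal m) (k : ℕ) :
    S.state (c • u) k = c • S.state u k := by
  induction k with
  | zero => simp [state]
  | succ k ih =>
    simp only [state, ih, Pi.smul_apply, WithLp.ofLp_smul, Matrix.mulVec_smul, smul_add]

theorem output_add (u v : Signal m) : S.output (u + v) = S.output u + S.output v := by
  funext k
  simp only [output, state_add, Pi.add_apply, WithLp.ofLp_add, Matrix.mulVec_add,
    ← WithLp.toLp_add]
  congr 1
  abel

theorem output_smul (c : ℂ) (u : Signal m) : S.output (c • u) = c • S.output u := by
  funext k
  simp only [output, state_smul, Pi.smul_apply, WithLp.ofLp_smul, Matrix.mulVec_smul,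
    ← WithLp.toLp_smul, smul_add]

/-- The explicit convolution formula `y_k = ∑_{i<k} C A^{k-1-i} B u_i + D u_k`. -/
theorem output_eq (u : Signal m) (k : ℕ) :
    S.output u k = WithLp.toLp 2
      (∑ i ∈ Finset.range k,
          (S.C * S.A ^ (k - 1 - i) * S.B).map Complex.ofReal *ᵥ (u i).ofLp
        + S.D.map Complex.ofReal *ᵥ (u k).ofLp) := by
  have h : ∀ k, S.state u k = ∑ i ∈ Finset.range k,
      (S.A ^ (k - 1 - i) * S.B).map Complex.ofReal *ᵥ (u i).ofLp := by
    intro k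
    induction k with
    | zero => simp [state]
    | succ k ih =>
      rw [Finset.sum_range_succ, state, ih, Matrix.mulVec_sum]
      simp only [add_tsub_cancel_right, tsub_self, pow_zero, Matrix.one_mul]
      congr 1
      refine Finset.sum_congr rfl fun i hi => ?_
      have hi' : k - i = (k - 1 - i) + 1 := by
        have := Finset.mem_range.1 hi
        omega
      rw [Matrix.mulVec_mulVec, hi', pow_succ', Matrix.mul_assoc]
      exact congrArg (· *ᵥ (u i).ofLp) (Matrix.map_mul (f := Complex.ofRealHom)).symm
  rw [output, h, Matrix.mulVec_sum]
  congr 2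
  refine Finset.sum_congr rfl fun i _ => ?_
  rw [Matrix.mulVec_mulVec, Matrix.mul_assoc]
  exact congrArg (· *ᵥ (u i).ofLp) (Matrix.map_mul (f := Complex.ofRealHom)).symm

/-- A realisation is minimal if no realisation of the same input-output map has fewer states. -/
def IsMinimal : Prop :=
  ∀ (n' : ℕ) (S' : LTI n' m), (∀ u : Signal m, S'.output u = S.output u) → n ≤ n'

/-- The operator from `u` to `y` on `ℓ₂`, with domain `{u ∈ ℓ₂ | y ∈ ℓ₂}`. -/
def opT : EllTwo m →ₗ.[ℂ] EllTwo m where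
  domain :=
    { carrier := {u | Memℓp (S.output u) 2}
      zero_mem' := by
        have h : S.output 0 = 0 := by simpa using S.output_smul 0 0
        change Memℓp (S.output 0) 2
        rw [h]
        exact zero_memℓp
      add_mem' := fun {u v} hu hv => by
        change Memℓp (S.output (⇑u + ⇑v)) 2
        rw [output_add]
        exact Memℓp.add hu hv
      smul_mem' := fun c u hu => by
        change Memℓp (S.output (c • ⇑u)) 2
        rw [output_smul]
        exact Memℓp.const_smul hu c }
  toFun :=
    { toFun := fun u => ⟨S.output u.1, u.2⟩
      map_add' := fun u v => Subtype.ext (S.output_add u.1 v.1)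
      map_smul' := fun c u => Subtype.ext (S.output_smul c u.1) }

/-- The output truncated to the times `k < τ`. -/
def truncOutput (τ : ℕ) (u : Signal m) : Signal m := fun k => if k < τ then S.output u k else 0

theorem truncOutput_memℓp (τ : ℕ) (u : Signal m) : Memℓp (S.truncOutput τ u) 2 := by
  refine memℓp_gen (summable_of_ne_finset_zero (s := Finset.range τ) fun k hk => ?_)
  have hk' : ¬ k < τ := by simpa using hk
  simp [truncOutput, hk']

/-- The operator from `u` to `y` on the truncated space, inputs and outputs vanishing at all
times `k ≥ τ`. -/
def opTrunc (τ : ℕ) : ellTwoTrunc m τ →ₗ.[ℂ] ellTwoTrunc m τ :=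
  LinearMap.toPMap
    { toFun := fun u =>
        ⟨⟨S.truncOutput τ u.1, S.truncOutput_memℓp τ u.1⟩,
          fun _ hk => if_neg (not_lt.2 hk)⟩
      map_add' := fun u v => by
        refine Subtype.ext (Subtype.ext (funext fun k => ?_))
        change S.truncOutput τ (⇑u.1 + ⇑v.1) k = S.truncOutput τ u.1 k + S.truncOutput τ v.1 k
        by_cases hk : k < τ <;> simp [truncOutput, output_add, hk]
      map_smul' := fun c u => by
        refine Subtype.ext (Subtype.ext (funext fun k => ?_))
        change S.truncOutput τ (c • ⇑u.1) k = c • S.truncOutput τ u.1 k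
        by_cases hk : k < τ <;> simp [truncOutput, output_smul, hk] }
    ⊤

/-- The linear matrix inequality for the maximum gain. -/
def MaxLMI (P : Matrix (Fin n) (Fin n) ℝ) (γ : ℝ) : Prop :=
  (-(Matrix.fromBlocks
      (S.Aᵀ * P * S.A - P + S.Cᵀ * S.C) (S.Aᵀ * P * S.B + S.Cᵀ * S.D)
      (S.Bᵀ * P * S.A + S.Dᵀ * S.C)
      (S.Bᵀ * P * S.B + S.Dᵀ * S.D - γ ^ 2 • (1 : Matrix (Fin m) (Fin m) ℝ)))).PosSemidef

/-- The linear matrix inequality for the minimum gain. -/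
def MinLMI (P : Matrix (Fin n) (Fin n) ℝ) (ζ : ℝ) : Prop :=
  (-(Matrix.fromBlocks
      (S.Aᵀ * P * S.A - P - S.Cᵀ * S.C) (S.Aᵀ * P * S.B - S.Cᵀ * S.D)
      (S.Bᵀ * P * S.A - S.Dᵀ * S.C)
      (S.Bᵀ * P * S.B - S.Dᵀ * S.D + ζ ^ 2 • (1 : Matrix (Fin m) (Fin m) ℝ)))).PosSemidef

end LTI

end GainLMI

end

/-! A gain bound says that the total of a running cost `a |u|² + b |y|²` is nonnegative, with `(a,
b) = (γ², -1)` or `(-ζ², 1)`. The LMI says that `V x = xᵀ P x` is a storage function: `V (A x + B u)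
≤ V x + cost`.

Summing this inequality from `x₀ = 0` bounds `V x_N` by the accumulated cost. If `P ⪰ 0` the term `V
x_N` can be dropped. If instead input and output lie in `ℓ₂`, observability forces `x_N → 0`, so `V
x_N → 0` whatever the sign of `P`.

Conversely, take for `V` the required supply, the infimal cost of reaching `x` from the origin
(`exists_storage`). Reachability makes it an infimum over a nonempty set. On finite horizons all
costs are nonnegative, hence so is `V`. On the infinite horizon only loops through the origin are
known to have nonnegative cost, but steering `x` back to the origin closes a loop and bounds `V x`
below. Such a `V` is homogeneous, satisfies the parallelogram law and is bounded above on segments,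
hence is a quadratic form.

Minimality enters only through reachability and observability. The limits exist because the
truncated gains are monotone in the horizon. -/

/-! ### Quadratic forms from the parallelogram law -/

/-- An additive function on `ℝ` that is bounded above on `[-1, 1]` is linear. -/
theorem AddMonoidHom.eq_mul_of_le_on_unit_interval (f : ℝ →+ ℝ) {M : ℝ}
    (hM : ∀ t, |t| ≤ 1 → f t ≤ M) (t : ℝ) : f t = t * f 1 := by
  have key : ∀ t, f t - t * f 1 ≤ 0 := by
    intro t
    by_contra! hd
    -- The defect `f t - t * f 1` is additive and vanishes at integers. So at `N * t` it is `N`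
    -- times the original, yet equals its value at the fractional part, which is at most `M + |f
    -- 1|`.
    obtain ⟨N, hN⟩ := exists_nat_gt ((M + |f 1|) / (f t - t * f 1))
    rw [div_lt_iff₀ hd] at hN
    have h1 : f (N * t) = N * f t := by simpa using map_nsmul f N t
    have h2 : f (N * t) = ⌊(N * t : ℝ)⌋ * f 1 + f (Int.fract (N * t : ℝ)) := by
      conv_lhs => rw [← Int.floor_add_fract (N * t : ℝ), map_add]
      congr 1
      simpa using map_zsmul f ⌊(N * t : ℝ)⌋ (1 : ℝ)
    have h3 := Int.fract_nonneg (N * t : ℝ)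
    have h4 := (Int.fract_lt_one (N * t : ℝ)).le
    have h5 := hM (Int.fract (N * t : ℝ)) (abs_le.2 ⟨by linarith, h4⟩)
    have h6 := Int.floor_add_fract (N * t : ℝ)
    have h7 : -(Int.fract (N * t : ℝ) * f 1) ≤ |f 1| := by
      refine (neg_le_abs _).trans ?_
      rw [abs_mul, abs_of_nonneg h3]
      exact mul_le_of_le_one_left (abs_nonneg _) h4
    have h8 : (⌊(N * t : ℝ)⌋ : ℝ) = N * t - Int.fract (N * t : ℝ) := by linarith
    rw [h8] at h2
    nlinarith
  have h1 := key t
  have h2 := key (-t)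
  rw [map_neg] at h2
  linarith

/-- A homogeneous function satisfying the parallelogram law is a quadratic form as soon as it is
bounded above on segments. -/
theorem exists_quadraticForm_of_parallelogram {E : Type*} [AddCommGroup E] [Module ℝ E]
    (V : E → ℝ) (hsmul : ∀ (t : ℝ) x, V (t • x) = t ^ 2 * V x)
    (hpar : ∀ x y, V (x + y) + V (x - y) = 2 * V x + 2 * V y)
    (hbdd : ∀ x y, ∃ M, ∀ t : ℝ, |t| ≤ 1 → V (t • x + y) ≤ M) :
    ∃ Q : QuadraticForm ℝ E, ∀ x, Q x = V x := by
  -- Jordan–von Neumann: this identity makes the polar form `f` additive.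
  have hadd : ∀ x y z, V (x + y + z) + V x + V y + V z = V (x + y) + V (y + z) + V (x + z) := by
    intro x y z
    have h1 := hpar (x + z) (y + z)
    have h2 := hpar (x + y + z) z
    have h3 := hpar x y
    rw [show x + z + (y + z) = x + y + z + z by abel, show x + z - (y + z) = x - y by abel] at h1
    rw [show x + y + z - z = x + y by abel] at h2
    linarith
  let f (y x : E) : ℝ := V (x + y) - V x - V y
  have hf_add : ∀ y x x', f y (x + x') = f y x + f y x' := by
    intro y x x'
    have := hadd x x' y
    simp only [f]
    linarith
  have hf_comm : ∀ x y, f x y = f y x := fun x y => by simp only [f, add_comm x y]; ring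
  have hf_smul : ∀ y (t : ℝ) x, f y (t • x) = t * f y x := by
    intro y t x
    let g : ℝ →+ ℝ := AddMonoidHom.mk' (fun t => f y (t • x)) fun a b => by
      rw [add_smul, hf_add]
    obtain ⟨M, hM⟩ := hbdd x y
    have := g.eq_mul_of_le_on_unit_interval (M := M + |V x| + |V y|) (fun t ht => ?_) t
    · simpa [g] using this
    · have h1 := hM t ht
      have h2 : -(t ^ 2 * V x) ≤ |V x| := by
        refine (neg_le_abs _).trans ?_
        rw [abs_mul, abs_of_nonneg (sq_nonneg t)]
        exact mul_le_of_le_one_left (abs_nonneg _) ((sq_le_one_iff_abs_le_one t).2 ht)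
      have h3 := neg_le_abs (V y)
      simp only [g, AddMonoidHom.mk'_apply, f, hsmul]
      linarith
  refine ⟨⟨V, fun a x => by rw [hsmul, smul_eq_mul, sq],
    LinearMap.mk₂ ℝ (fun x y => f y x) (fun x x' y => hf_add y x x')
      (fun c x y => by simpa using hf_smul y c x)
      (fun x y y' => by rw [hf_comm, hf_add, hf_comm, hf_comm y'])
      (fun c x y => by rw [hf_comm, hf_smul, hf_comm, smul_eq_mul]), fun x y => ?_⟩, fun x => rfl⟩
  simp only [LinearMap.mk₂_apply, f]
  ring

namespace GainLMI

/-! ### Optimal transfer costs and the required supply -/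

section Transfer

variable {E U : Type*} [AddCommGroup E] [Module ℝ E] [AddCommGroup U] [Module ℝ U]

/-- A running cost that is quadratic jointly in the state and the input. -/
def IsQuadraticCost (s : E → U → ℝ) : Prop :=
  ∀ x u x' u', ∃ c, ∀ a b : ℝ,
    s (a • x + b • x') (a • u + b • u') = a ^ 2 * s x u + a * b * c + b ^ 2 * s x' u'

/-- `Transfer A B s N x y q`: some input takes `x_{k+1} = A x_k + B u_k` from `x` to `y` in `N`
steps, at total cost `q`. -/
def Transfer (A : E →ₗ[ℝ] E) (B : U →ₗ[ℝ] E) (s : E → U → ℝ) : ℕ → E → E → ℝ → Prop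
  | 0, x, y, q => y = x ∧ q = 0
  | N + 1, x, y, q => ∃ y' q' u, Transfer A B s N x y' q' ∧ y = A y' + B u ∧ q = q' + s y' u

variable {A : E →ₗ[ℝ] E} {B : U →ₗ[ℝ] E} {s : E → U → ℝ}

theorem IsQuadraticCost.zero (hs : IsQuadraticCost s) : s 0 0 = 0 := by
  obtain ⟨c, hc⟩ := hs 0 0 0 0
  simpa using hc 0 0

theorem Transfer.trans {N M : ℕ} {x y z : E} {q q' : ℝ} (h : Transfer A B s N x y q)
    (h' : Transfer A B s M y z q') : Transfer A B s (N + M) x z (q + q') := by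
  induction M generalizing z q' with
  | zero =>
    obtain ⟨rfl, rfl⟩ := h'
    simpa using h
  | succ M ih =>
    obtain ⟨y', r, u, h1, rfl, rfl⟩ := h'
    exact ⟨y', q + r, u, ih h1, rfl, by ring⟩

/-- The cross coefficient `c` does not depend on `a` and `b`, so it cancels between the combinations
`(1, 1)` and `(1, -1)`. -/
theorem Transfer.combine (hs : IsQuadraticCost s) {N : ℕ} {x x' y y' : E} {q q' : ℝ}
    (h : Transfer A B s N x y q) (h' : Transfer A B s N x' y' q') :
    ∃ c, ∀ a b : ℝ, Transfer A B s N (a • x + b • x') (a • y + b • y')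
      (a ^ 2 * q + a * b * c + b ^ 2 * q') := by
  induction N generalizing y y' q q' with
  | zero =>
    obtain ⟨rfl, rfl⟩ := h
    obtain ⟨rfl, rfl⟩ := h'
    exact ⟨0, fun a b => ⟨rfl, by ring⟩⟩
  | succ N ih =>
    obtain ⟨z, r, u, h1, rfl, rfl⟩ := h
    obtain ⟨z', r', u', h1', rfl, rfl⟩ := h'
    obtain ⟨c, hc⟩ := ih h1 h1'
    obtain ⟨d, hd⟩ := hs z u z' u'
    refine ⟨c + d, fun a b => ⟨_, _, a • u + b • u', hc a b, ?_, ?_⟩⟩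
    · simp only [map_add, map_smul, smul_add]
      abel
    · rw [hd]
      ring

theorem Transfer.step (x : E) (u : U) : Transfer A B s 1 x (A x + B u) (s x u) :=
  ⟨x, 0, u, ⟨rfl, rfl⟩, rfl, by ring⟩

theorem Transfer.exists_free (N : ℕ) (x : E) : ∃ y q, Transfer A B s N x y q := by
  induction N with
  | zero => exact ⟨x, 0, rfl, rfl⟩
  | succ N ih =>
    obtain ⟨y, q, h⟩ := ih
    exact ⟨_, _, h.trans (Transfer.step y 0)⟩

/-- Idling at the origin costs nothing, so idle steps can be put in front; this brings two transfers
from the origin to a common length. -/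
theorem Transfer.mono (hs : IsQuadraticCost s) {N M : ℕ} (hNM : N ≤ M) {y : E} {q : ℝ}
    (h : Transfer A B s N 0 y q) : Transfer A B s M 0 y q := by
  induction M, hNM using Nat.le_induction with
  | base => exact h
  | succ M _ ih =>
    have h0 : Transfer A B s 1 0 0 0 := by
      simpa [hs.zero] using Transfer.step (A := A) (B := B) (s := s) 0 0
    simpa [add_comm] using h0.trans ih

/-- The states reachable from the origin in `N` steps. -/
def reachable (A : E →ₗ[ℝ] E) (B : U →ₗ[ℝ] E) (hs : IsQuadraticCost s) : ℕ →o Submodule ℝ E where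
  toFun N :=
    { carrier := {y | ∃ q, Transfer A B s N 0 y q}
      zero_mem' := ⟨0, Transfer.mono hs (Nat.zero_le N) ⟨rfl, rfl⟩⟩
      add_mem' := by
        rintro y y' ⟨q, h⟩ ⟨q', h'⟩
        obtain ⟨c, hc⟩ := h.combine hs h'
        exact ⟨_, by simpa using hc 1 1⟩
      smul_mem' := by
        rintro a y ⟨q, h⟩
        obtain ⟨c, hc⟩ := h.combine hs h
        exact ⟨_, by simpa using hc a 0⟩ }
  monotone' := fun _ _ hNM _ ⟨q, h⟩ => ⟨q, h.mono hs hNM⟩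

/-- The increasing reachable subspaces stabilise in finite dimension; the stable one is
`A`-invariant and contains the range of `B`. -/
theorem exists_reachable_eq_top [FiniteDimensional ℝ E] (hs : IsQuadraticCost s)
    (hctrl : ∀ R : Submodule ℝ E, (∀ x ∈ R, A x ∈ R) → (∀ u, B u ∈ R) → R = ⊤) :
    ∃ N, ∀ x, ∃ q, Transfer A B s N 0 x q := by
  obtain ⟨N, hN⟩ := monotone_stabilizes_iff_noetherian.2 inferInstance (reachable A B hs)
  have htop := hctrl (reachable A B hs N) ?_ ?_
  · exact ⟨N, fun x => (htop ▸ Submodule.mem_top : x ∈ reachable A B hs N)⟩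
  · rintro x ⟨q, h⟩
    rw [hN (N + 1) N.le_succ]
    exact ⟨_, by simpa using h.trans (Transfer.step x 0)⟩
  · intro u
    rw [hN (N + 1) N.le_succ]
    refine (reachable A B hs).monotone (Nat.le_add_left 1 N) ⟨s 0 u, ?_⟩
    simpa using Transfer.step (A := A) (B := B) (s := s) 0 u

/-- If every state is reachable, then every state can be steered to the origin. -/
theorem exists_transfer_zero (hs : IsQuadraticCost s) {N : ℕ}
    (hN : ∀ x, ∃ q, Transfer A B s N 0 x q) (x : E) : ∃ q, Transfer A B s N x 0 q := by
  -- Drift for `N` steps to `y`, and superpose a transfer of the same length from `0` to `-y`.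
  obtain ⟨y, q, h⟩ := Transfer.exists_free (A := A) (B := B) (s := s) N x
  obtain ⟨q', h'⟩ := hN (-y)
  obtain ⟨c, hc⟩ := h.combine hs h'
  exact ⟨_, by simpa using hc 1 1⟩

/-- The required supply: the least cost of reaching a state from the origin. -/
noncomputable def requiredSupply (A : E →ₗ[ℝ] E) (B : U →ₗ[ℝ] E) (s : E → U → ℝ) (x : E) : ℝ :=
  sInf {q | ∃ N, Transfer A B s N 0 x q}

/-- If every state is reachable and the cost of reaching each state is bounded below, the
required supply is a quadratic storage function. -/
theorem exists_storage (hs : IsQuadraticCost s) (hreach : ∀ x, ∃ N q, Transfer A B s N 0 x q)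
    (hbdd : ∀ x, BddBelow {q | ∃ N, Transfer A B s N 0 x q}) :
    ∃ Q : QuadraticForm ℝ E, (∀ x, Q x = requiredSupply A B s x) ∧
      ∀ x u, Q (A x + B u) ≤ Q x + s x u := by
  set V := requiredSupply A B s with hV
  have hne : ∀ x, {q | ∃ N, Transfer A B s N 0 x q}.Nonempty := fun x => by
    obtain ⟨N, q, h⟩ := hreach x
    exact ⟨q, N, h⟩
  have hle : ∀ {N x q}, Transfer A B s N 0 x q → V x ≤ q := fun h => csInf_le (hbdd _) ⟨_, h⟩
  have hge : ∀ {x r}, (∀ N q, Transfer A B s N 0 x q → r ≤ q) → r ≤ V x := fun h =>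
    le_csInf (hne _) fun q ⟨N, hq⟩ => h N q hq
  have hcomb : ∀ {N N' x x' q q'}, Transfer A B s N 0 x q → Transfer A B s N' 0 x' q' →
      ∃ c, ∀ a b : ℝ, V (a • x + b • x') ≤ a ^ 2 * q + a * b * c + b ^ 2 * q' := by
    intro N N' x x' q q' h h'
    obtain ⟨c, hc⟩ := (h.mono hs (le_max_left N N')).combine hs (h'.mono hs (le_max_right N N'))
    exact ⟨c, fun a b => hle (N := max N N') (by simpa using hc a b)⟩
  have hsmul_le : ∀ (t : ℝ) x, V (t • x) ≤ t ^ 2 * V x := by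
    intro t x
    rcases eq_or_ne t 0 with rfl | ht
    · simpa using hle (N := 0) (x := (0 : E)) ⟨rfl, rfl⟩
    · rw [← div_le_iff₀' (by positivity)]
      refine hge fun N q h => ?_
      obtain ⟨c, hc⟩ := hcomb h h
      rw [div_le_iff₀' (by positivity)]
      simpa using hc t 0
  have hsmul : ∀ (t : ℝ) x, V (t • x) = t ^ 2 * V x := by
    intro t x
    refine (hsmul_le t x).antisymm ?_
    rcases eq_or_ne t 0 with rfl | ht
    -- `V 0 ≤ 4 * V 0` gives `0 ≤ V 0`.
    · have := hsmul_le 2 (0 : E)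
      simp only [smul_zero] at this
      simp only [zero_smul]
      linarith
    · have := hsmul_le t⁻¹ (t • x)
      rw [smul_smul, inv_mul_cancel₀ ht, one_smul, inv_pow] at this
      rwa [le_inv_mul_iff₀ (by positivity)] at this
  have hpar_le : ∀ x y, V (x + y) + V (x - y) ≤ 2 * V x + 2 * V y := by
    intro x y
    have : ((V (x + y) + V (x - y)) - 2 * V y) / 2 ≤ V x := by
      refine hge fun N q h => ?_
      have : ((V (x + y) + V (x - y)) - 2 * q) / 2 ≤ V y := by
        refine hge fun N' q' h' => ?_
        obtain ⟨c, hc⟩ := hcomb h h'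
        have h1 := hc 1 1
        have h2 := hc 1 (-1)
        simp only [one_smul, neg_smul, ← sub_eq_add_neg] at h1 h2
        linarith
      linarith
    linarith
  have hpar : ∀ x y, V (x + y) + V (x - y) = 2 * V x + 2 * V y := by
    intro x y
    refine (hpar_le x y).antisymm ?_
    -- The same inequality at `x + y` and `x - y`, with homogeneity, is the reverse one.
    have h := hpar_le (x + y) (x - y)
    rw [show x + y + (x - y) = (2 : ℝ) • x by rw [two_smul]; abel,
      show x + y - (x - y) = (2 : ℝ) • y by rw [two_smul]; abel, hsmul, hsmul] at h
    linarith
  obtain ⟨Q, hQ⟩ := exists_quadraticForm_of_parallelogram V hsmul hpar fun x y => by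
    obtain ⟨N, q, h⟩ := hreach x
    obtain ⟨N', q', h'⟩ := hreach y
    obtain ⟨c, hc⟩ := hcomb h h'
    refine ⟨|q| + |c| + |q'|, fun t ht => ?_⟩
    have h1 := hc t 1
    have h2 : t ^ 2 * q ≤ |q| := by
      refine (le_abs_self _).trans ?_
      rw [abs_mul, abs_of_nonneg (sq_nonneg t)]
      exact mul_le_of_le_one_left (abs_nonneg _) ((sq_le_one_iff_abs_le_one t).2 ht)
    have h3 : t * c ≤ |c| := by
      refine (le_abs_self _).trans ?_
      rw [abs_mul]
      exact mul_le_of_le_one_left (abs_nonneg _) ht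
    have h4 := le_abs_self q'
    rw [one_smul] at h1
    linarith
  refine ⟨Q, hQ, fun x u => ?_⟩
  rw [hQ, hQ, ← sub_le_iff_le_add]
  refine hge fun N q h => ?_
  rw [sub_le_iff_le_add]
  exact hle (h.trans (Transfer.step x u))

end Transfer

/-! ### Minimality, reachability and observability -/

/-- Restriction of a pair of matrices to an invariant subspace, in coordinates. -/
theorem exists_factor_of_invariant {n m : ℕ} (M : Matrix (Fin n) (Fin n) ℝ)
    (N : Matrix (Fin n) (Fin m) ℝ) (R : Submodule ℝ (Fin n → ℝ)) (hM : ∀ x ∈ R, M *ᵥ x ∈ R)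
    (hN : ∀ u, N *ᵥ u ∈ R) :
    ∃ (W : Matrix (Fin n) (Fin (Module.finrank ℝ R)) ℝ)
      (M' : Matrix (Fin (Module.finrank ℝ R)) (Fin (Module.finrank ℝ R)) ℝ)
      (N' : Matrix (Fin (Module.finrank ℝ R)) (Fin m) ℝ), M * W = W * M' ∧ N = W * N' := by
  let b := Module.finBasis ℝ R
  let W : Matrix (Fin n) (Fin (Module.finrank ℝ R)) ℝ := Matrix.of fun i j => (b j : Fin n → ℝ) i
  have hW : ∀ v : R, W *ᵥ b.repr v = v := by
    intro v
    ext i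
    have h := congrArg (fun w : R => (w : Fin n → ℝ) i) (b.sum_repr v)
    simp only [Submodule.coe_sum, Submodule.coe_smul, Finset.sum_apply, Pi.smul_apply,
      smul_eq_mul] at h
    exact (Finset.sum_congr rfl fun j _ => mul_comm ((b j : Fin n → ℝ) i) _).trans h
  have hlift : ∀ {k : ℕ} (L : Matrix (Fin n) (Fin k) ℝ) (_ : ∀ j, L.col j ∈ R),
      ∃ L' : Matrix (Fin (Module.finrank ℝ R)) (Fin k) ℝ, L = W * L' := by
    intro k L hL
    refine ⟨Matrix.of fun i j => b.repr ⟨_, hL j⟩ i, ?_⟩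
    ext i j
    exact (congrFun (hW ⟨_, hL j⟩) i).symm
  obtain ⟨M', hM'⟩ := hlift (M * W) fun j => hM _ (b j).2
  obtain ⟨N', hN'⟩ := hlift N fun j => by
    rw [← Matrix.mulVec_single_one]
    exact hN _
  exact ⟨W, M', N', hM', hN'⟩

theorem map_ofReal_mul {l m n : ℕ} (M : Matrix (Fin l) (Fin m) ℝ)
    (N : Matrix (Fin m) (Fin n) ℝ) :
    (M * N).map Complex.ofReal = M.map Complex.ofReal * N.map Complex.ofReal :=
  Matrix.map_mul (f := Complex.ofRealHom)

/-- Since the data are real, the real and imaginary parts of a complex trajectory are themselves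
trajectories; a general `φ` covers both. -/
theorem map_ofReal_mulVec_comp {l m : ℕ} (φ : ℂ →ₗ[ℝ] ℝ) (M : Matrix (Fin l) (Fin m) ℝ)
    (z : Fin m → ℂ) : φ ∘ (M.map Complex.ofReal *ᵥ z) = M *ᵥ (φ ∘ z) := by
  ext i
  simp only [Function.comp_apply, Matrix.mulVec, dotProduct, Matrix.map_apply, map_sum]
  refine Finset.sum_congr rfl fun j _ => ?_
  rw [← Complex.real_smul, map_smul, smul_eq_mul]

theorem map_ofReal_mulVec_ofReal {l m : ℕ} (M : Matrix (Fin l) (Fin m) ℝ) (x : Fin m → ℝ) :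
    M.map Complex.ofReal *ᵥ (Complex.ofReal ∘ x) = Complex.ofReal ∘ (M *ᵥ x) := by
  ext i
  simp [Matrix.mulVec, dotProduct]

theorem norm_sq_eq_re_add_im {m : ℕ} (w : EuclideanSpace ℂ (Fin m)) :
    ‖w‖ ^ 2 = (Complex.reLm ∘ w.ofLp) ⬝ᵥ (Complex.reLm ∘ w.ofLp) +
      (Complex.imLm ∘ w.ofLp) ⬝ᵥ (Complex.imLm ∘ w.ofLp) := by
  rw [EuclideanSpace.norm_sq_eq, dotProduct, dotProduct, ← Finset.sum_add_distrib]
  refine Finset.sum_congr rfl fun i _ => ?_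
  rw [Complex.sq_norm, Complex.normSq_apply]
  rfl

namespace LTI

variable {n m : ℕ} (S : LTI n m)

/-- The trajectories from the origin stay in the complexification of `R`, so restricting to `R`
realises the same map with `finrank R` states. -/
theorem IsMinimal.eq_top_of_reachable {S : LTI n m} (hS : S.IsMinimal)
    (R : Submodule ℝ (Fin n → ℝ)) (hA : ∀ x ∈ R, S.A *ᵥ x ∈ R) (hB : ∀ u, S.B *ᵥ u ∈ R) :
    R = ⊤ := by
  obtain ⟨W, A', B', hA', hB'⟩ := exists_factor_of_invariant S.A S.B R hA hB
  refine Submodule.eq_top_of_finrank_eq (le_antisymm (Submodule.finrank_le R) ?_)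
  rw [Module.finrank_fin_fun]
  have hstate : ∀ u k, S.state u k =
      W.map Complex.ofReal *ᵥ (LTI.mk A' B' (S.C * W) S.D).state u k := by
    intro u k
    induction k with
    | zero => simp [state]
    | succ k ih =>
      simp only [state, ih, Matrix.mulVec_add, Matrix.mulVec_mulVec, ← map_ofReal_mul, hA']
      rw [← hB']
  refine hS _ ⟨A', B', S.C * W, S.D⟩ fun u => funext fun k => ?_
  simp only [output, hstate u k, Matrix.mulVec_mulVec, map_ofReal_mul]

/-- The dual reduction: the output depends on the state only through `Wᵀ x`, which evolves
autonomously up to the input. -/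
theorem IsMinimal.eq_top_of_observable {S : LTI n m} (hS : S.IsMinimal)
    (R : Submodule ℝ (Fin n → ℝ)) (hA : ∀ x ∈ R, S.Aᵀ *ᵥ x ∈ R) (hC : ∀ u, S.Cᵀ *ᵥ u ∈ R) :
    R = ⊤ := by
  obtain ⟨W, A', C', hA', hC'⟩ := exists_factor_of_invariant S.Aᵀ S.Cᵀ R hA hC
  refine Submodule.eq_top_of_finrank_eq (le_antisymm (Submodule.finrank_le R) ?_)
  rw [Module.finrank_fin_fun]
  have hA'' : Wᵀ * S.A = A'ᵀ * Wᵀ := by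
    simpa [Matrix.transpose_mul] using congrArg Matrix.transpose hA'
  have hC'' : S.C = C'ᵀ * Wᵀ := by
    simpa [Matrix.transpose_mul] using congrArg Matrix.transpose hC'
  have hstate : ∀ u k, (LTI.mk A'ᵀ (Wᵀ * S.B) C'ᵀ S.D).state u k =
      Wᵀ.map Complex.ofReal *ᵥ S.state u k := by
    intro u k
    induction k with
    | zero => simp [state]
    | succ k ih =>
      simp only [state, ih, Matrix.mulVec_add, Matrix.mulVec_mulVec, ← map_ofReal_mul, hA'']
  refine hS _ ⟨A'ᵀ, Wᵀ * S.B, C'ᵀ, S.D⟩ fun u => funext fun k => ?_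
  simp only [output, hstate u k, Matrix.mulVec_mulVec, ← map_ofReal_mul]
  rw [← hC'']

theorem state_congr {u v : Signal m} {k : ℕ} (h : ∀ j < k, u j = v j) :
    S.state u k = S.state v k := by
  induction k with
  | zero => rfl
  | succ k ih =>
    rw [state, state, ih fun j hj => h j (hj.trans k.lt_succ_self), h k k.lt_succ_self]

theorem output_congr {u v : Signal m} {k : ℕ} (h : ∀ j ≤ k, u j = v j) :
    S.output u k = S.output v k := by
  rw [output, output, S.state_congr fun j hj => h j hj.le, h k le_rfl]

/-- The delayed signal `0, u₀, u₁, …`. -/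
def delay (u : Signal m) : Signal m
  | 0 => 0
  | k + 1 => u k

theorem state_delay (u : Signal m) (k : ℕ) : S.state (delay u) (k + 1) = S.state u k := by
  induction k with
  | zero => simp [state, delay]
  | succ k ih => rw [state, ih, state, delay]

theorem output_delay_zero (u : Signal m) : S.output (delay u) 0 = 0 := by
  simp [output, state, delay]

theorem output_delay_succ (u : Signal m) (k : ℕ) :
    S.output (delay u) (k + 1) = S.output u k := by
  rw [output, output, state_delay, delay]

theorem comp_state_succ (φ : ℂ →ₗ[ℝ] ℝ) (u : Signal m) (k : ℕ) :
    φ ∘ S.state u (k + 1) = S.A *ᵥ (φ ∘ S.state u k) + S.B *ᵥ (φ ∘ (u k).ofLp) := by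
  rw [← map_ofReal_mulVec_comp, ← map_ofReal_mulVec_comp, state]
  ext i
  simp

theorem comp_output (φ : ℂ →ₗ[ℝ] ℝ) (u : Signal m) (k : ℕ) :
    φ ∘ (S.output u k).ofLp = S.C *ᵥ (φ ∘ S.state u k) + S.D *ᵥ (φ ∘ (u k).ofLp) := by
  rw [← map_ofReal_mulVec_comp, ← map_ofReal_mulVec_comp, output]
  ext i
  simp

/-- By observability, the state tends to zero along with input and output. -/
theorem IsMinimal.tendsto_state {S : LTI n m} (hS : S.IsMinimal) (φ : ℂ →ₗ[ℝ] ℝ) {u : Signal m}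
    (hu : Tendsto u atTop (𝓝 0)) (hy : Tendsto (S.output u) atTop (𝓝 0)) :
    Tendsto (fun k => φ ∘ S.state u k) atTop (𝓝 0) := by
  have hφ : ∀ {w : Signal m}, Tendsto w atTop (𝓝 0) →
      Tendsto (fun k => φ ∘ (w k).ofLp) atTop (𝓝 0) := by
    intro w hw
    have hc : Continuous fun z : EuclideanSpace ℂ (Fin m) => φ ∘ z.ofLp :=
      continuous_pi fun i => φ.continuous_of_finiteDimensional.comp
        ((continuous_apply i).comp (PiLp.continuous_ofLp 2 _))
    have h0 : (φ ∘ (0 : EuclideanSpace ℂ (Fin m)).ofLp) = 0 := by ext; simp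
    have h := (hc.tendsto 0).comp hw
    rwa [h0] at h
  have hdot : ∀ {k : ℕ} {f : ℕ → Fin k → ℝ} (v : Fin k → ℝ), Tendsto f atTop (𝓝 0) →
      Tendsto (fun j => v ⬝ᵥ f j) atTop (𝓝 0) := by
    intro k f v hf
    have hc : Continuous fun z : Fin k → ℝ => v ⬝ᵥ z := by fun_prop
    simpa [Function.comp_def] using (hc.tendsto 0).comp hf
  -- The covectors along which the state decays. They are stable under `Aᵀ` since `v ⬝ x_{k+1} = Aᵀ
  -- v ⬝ x_k + v ⬝ B u_k`, and contain the range of `Cᵀ` since `C x = y - D u`.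
  let R : Submodule ℝ (Fin n → ℝ) :=
    { carrier := {v | Tendsto (fun k => v ⬝ᵥ (φ ∘ S.state u k)) atTop (𝓝 0)}
      zero_mem' := by simp
      add_mem' := fun {v w} hv hw => by simpa [add_dotProduct] using Tendsto.add hv hw
      smul_mem' := fun c v hv => by simpa [smul_dotProduct] using Tendsto.const_mul c hv }
  have hR : R = ⊤ := by
    refine hS.eq_top_of_observable R (fun v hv => ?_) fun v => ?_
    · have h1 : Tendsto (fun k => v ⬝ᵥ (φ ∘ S.state u (k + 1))) atTop (𝓝 0) :=
        (tendsto_add_atTop_iff_nat 1).2 hv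
      have h2 := h1.sub (hdot (v ᵥ* S.B) (hφ hu))
      rw [sub_zero] at h2
      refine h2.congr fun k => ?_
      rw [comp_state_succ, dotProduct_add, Matrix.mulVec_transpose, ← Matrix.dotProduct_mulVec,
        ← Matrix.dotProduct_mulVec, add_sub_cancel_right]
    · have h2 := (hdot v (hφ hy)).sub (hdot (v ᵥ* S.D) (hφ hu))
      rw [sub_zero] at h2
      refine h2.congr fun k => ?_
      rw [comp_output, dotProduct_add, Matrix.mulVec_transpose, ← Matrix.dotProduct_mulVec,
        ← Matrix.dotProduct_mulVec, add_sub_cancel_right]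
  refine tendsto_pi_nhds.2 fun i => ?_
  have hi : Pi.single i 1 ∈ R := hR ▸ Submodule.mem_top
  exact Tendsto.congr (fun k => by simp) hi

/-! ### Dissipativity and the bounded-real lemmas -/

/-- The running cost `a |u|² + b |y|²`, with `y = C x + D u`. -/
def cost (a b : ℝ) (x : Fin n → ℝ) (u : Fin m → ℝ) : ℝ :=
  a * (u ⬝ᵥ u) + b * ((S.C *ᵥ x + S.D *ᵥ u) ⬝ᵥ (S.C *ᵥ x + S.D *ᵥ u))

theorem isQuadraticCost_cost (a b : ℝ) : IsQuadraticCost (S.cost a b) := by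
  intro x u x' u'
  refine ⟨2 * (a * (u ⬝ᵥ u') +
    b * ((S.C *ᵥ x + S.D *ᵥ u) ⬝ᵥ (S.C *ᵥ x' + S.D *ᵥ u'))), fun c d => ?_⟩
  have h : S.C *ᵥ (c • x + d • x') + S.D *ᵥ (c • u + d • u') =
      c • (S.C *ᵥ x + S.D *ᵥ u) + d • (S.C *ᵥ x' + S.D *ᵥ u') := by
    simp only [Matrix.mulVec_add, Matrix.mulVec_smul, smul_add]
    abel
  rw [cost, h, cost, cost]
  generalize S.C *ᵥ x + S.D *ᵥ u = y
  generalize S.C *ᵥ x' + S.D *ᵥ u' = y'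
  simp only [add_dotProduct, dotProduct_add, smul_dotProduct, dotProduct_smul, smul_eq_mul,
    dotProduct_comm u' u, dotProduct_comm y' y]
  ring

theorem cost_re_add_cost_im (a b : ℝ) (u : Signal m) (k : ℕ) :
    S.cost a b (Complex.reLm ∘ S.state u k) (Complex.reLm ∘ (u k).ofLp) +
      S.cost a b (Complex.imLm ∘ S.state u k) (Complex.imLm ∘ (u k).ofLp) =
    a * ‖u k‖ ^ 2 + b * ‖S.output u k‖ ^ 2 := by
  simp only [cost, ← comp_output, norm_sq_eq_re_add_im]
  ring

/-- Dissipativity with storage `x ↦ xᵀ P x` and supply `a |u|² + b |y|²`. -/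
def IsDissipative (P : Matrix (Fin n) (Fin n) ℝ) (a b : ℝ) : Prop :=
  ∀ x u, (S.A *ᵥ x + S.B *ᵥ u) ⬝ᵥ P *ᵥ (S.A *ᵥ x + S.B *ᵥ u) ≤ x ⬝ᵥ P *ᵥ x + S.cost a b x u

variable {S}

theorem IsDissipative.le_sum {P : Matrix (Fin n) (Fin n) ℝ} {a b : ℝ} (h : S.IsDissipative P a b)
    (u : Signal m) (N : ℕ) :
    (Complex.reLm ∘ S.state u N) ⬝ᵥ P *ᵥ (Complex.reLm ∘ S.state u N) +
      (Complex.imLm ∘ S.state u N) ⬝ᵥ P *ᵥ (Complex.imLm ∘ S.state u N) ≤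
    ∑ k ∈ Finset.range N, (a * ‖u k‖ ^ 2 + b * ‖S.output u k‖ ^ 2) := by
  induction N with
  | zero =>
    have h0 : ∀ φ : ℂ →ₗ[ℝ] ℝ, φ ∘ S.state u 0 = 0 := fun φ => by ext; simp [state]
    rw [h0, h0]
    simp
  | succ N ih =>
    rw [Finset.sum_range_succ, ← cost_re_add_cost_im, comp_state_succ, comp_state_succ]
    have h1 := h (Complex.reLm ∘ S.state u N) (Complex.reLm ∘ (u N).ofLp)
    have h2 := h (Complex.imLm ∘ S.state u N) (Complex.imLm ∘ (u N).ofLp)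
    linarith

theorem exists_signal_of_transfer {a b : ℝ} {N : ℕ} {x : Fin n → ℝ} {q : ℝ}
    (h : Transfer S.A.mulVecLin S.B.mulVecLin (S.cost a b) N 0 x q) :
    ∃ u : Signal m, (∀ k, N ≤ k → u k = 0) ∧ S.state u N = Complex.ofReal ∘ x ∧
      ∑ k ∈ Finset.range N, (a * ‖u k‖ ^ 2 + b * ‖S.output u k‖ ^ 2) = q := by
  induction N generalizing x q with
  | zero =>
    obtain ⟨rfl, rfl⟩ := h
    exact ⟨0, fun _ _ => rfl, by ext; simp [state], by simp⟩
  | succ N ih =>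
    obtain ⟨x, q, v, h, rfl, rfl⟩ := h
    obtain ⟨u, hu0, hux, huq⟩ := ih h
    let u' : Signal m := Function.update u N (WithLp.toLp 2 (Complex.ofReal ∘ v))
    have hu' : ∀ k < N, u' k = u k := fun k hk => Function.update_of_ne hk.ne _ _
    have huN : u' N = WithLp.toLp 2 (Complex.ofReal ∘ v) := Function.update_self _ _ _
    have hsN : S.state u' N = Complex.ofReal ∘ x := by rw [S.state_congr hu', hux]
    have hre : ∀ {k : ℕ} (z : Fin k → ℝ), Complex.reLm ∘ (Complex.ofReal ∘ z) = z := fun z => by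
      ext; simp
    have him : ∀ {k : ℕ} (z : Fin k → ℝ), Complex.imLm ∘ (Complex.ofReal ∘ z) = 0 := fun z => by
      ext; simp
    refine ⟨u', fun k hk => ?_, ?_, ?_⟩
    · rw [← hu0 k (by omega)]
      exact Function.update_of_ne (by omega) _ _
    · rw [state, hsN, huN, map_ofReal_mulVec_ofReal, map_ofReal_mulVec_ofReal]
      ext i
      simp
    · rw [Finset.sum_range_succ, ← huq, ← cost_re_add_cost_im, hsN, huN]
      congr 1
      · refine Finset.sum_congr rfl fun k hk => ?_
        have hk := Finset.mem_range.1 hk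
        rw [hu' k hk, S.output_congr fun j hj => hu' j (hj.trans_lt hk)]
      · simp only [hre, him]
        simp [cost]

theorem exists_isDissipative (hS : S.IsMinimal) {a b : ℝ}
    (hbdd : ∀ x, BddBelow {q | ∃ N,
      Transfer S.A.mulVecLin S.B.mulVecLin (S.cost a b) N 0 x q}) :
    ∃ P : Matrix (Fin n) (Fin n) ℝ, P.IsSymm ∧ S.IsDissipative P a b ∧
      ∀ x, x ⬝ᵥ P *ᵥ x = requiredSupply S.A.mulVecLin S.B.mulVecLin (S.cost a b) x := by
  have hs := S.isQuadraticCost_cost a b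
  obtain ⟨N, hN⟩ := exists_reachable_eq_top (A := S.A.mulVecLin) (B := S.B.mulVecLin) hs
    hS.eq_top_of_reachable
  obtain ⟨Q, hQ, hdiss⟩ := exists_storage hs (fun x => ⟨N, hN x⟩) hbdd
  have hP : ∀ x, x ⬝ᵥ Q.toMatrix' *ᵥ x = Q x := fun x => by
    rw [QuadraticForm.toMatrix', ← Matrix.toLinearMap₂'_apply', Matrix.toLinearMap₂'_toMatrix']
    exact QuadraticMap.associated_eq_self_apply ℝ Q x
  refine ⟨Q.toMatrix', Q.isSymm_toMatrix', fun x u => ?_, fun x => by rw [hP, hQ]⟩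
  rw [hP, hP]
  exact hdiss x u

/-- Bounded-real lemma on finite horizons. -/
theorem exists_posSemidef_isDissipative_iff (hS : S.IsMinimal) {a b : ℝ} :
    (∃ P : Matrix (Fin n) (Fin n) ℝ, P.IsSymm ∧ P.PosSemidef ∧ S.IsDissipative P a b) ↔
      ∀ (u : Signal m) (N : ℕ),
        0 ≤ ∑ k ∈ Finset.range N, (a * ‖u k‖ ^ 2 + b * ‖S.output u k‖ ^ 2) := by
  constructor
  · rintro ⟨P, -, hP, h⟩ u N
    have h1 := hP.dotProduct_mulVec_nonneg (Complex.reLm ∘ S.state u N)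
    have h2 := hP.dotProduct_mulVec_nonneg (Complex.imLm ∘ S.state u N)
    simp only [star_trivial] at h1 h2
    linarith [h.le_sum u N]
  · intro h
    have hq : ∀ {x q}, (∃ N, Transfer S.A.mulVecLin S.B.mulVecLin (S.cost a b) N 0 x q) →
        0 ≤ q := by
      rintro x q ⟨N, hN⟩
      obtain ⟨u, -, -, rfl⟩ := exists_signal_of_transfer hN
      exact h u N
    obtain ⟨P, hsymm, hdiss, hP⟩ := exists_isDissipative hS (a := a) (b := b)
      fun x => ⟨0, fun q => hq⟩
    refine ⟨P, hsymm, Matrix.posSemidef_iff_dotProduct_mulVec.2 ⟨?_, fun x => ?_⟩, hdiss⟩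
    · rwa [Matrix.IsHermitian, Matrix.conjTranspose_eq_transpose_of_trivial]
    · rw [star_trivial, hP]
      exact Real.sInf_nonneg fun q => hq

/-- Bounded-real lemma on the infinite horizon, for square-summable input and output. -/
theorem exists_isDissipative_iff (hS : S.IsMinimal) {a b : ℝ} :
    (∃ P : Matrix (Fin n) (Fin n) ℝ, P.IsSymm ∧ S.IsDissipative P a b) ↔
      ∀ u : Signal m, Memℓp u 2 → Memℓp (S.output u) 2 →
        0 ≤ a * ∑' k, ‖u k‖ ^ 2 + b * ∑' k, ‖S.output u k‖ ^ 2 := by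
  have hsummable : ∀ {w : Signal m}, Memℓp w 2 → Summable fun k => ‖w k‖ ^ 2 := fun hw => by
    simpa using hw.summable (by norm_num)
  have htendsto : ∀ {w : Signal m}, Memℓp w 2 → Tendsto w atTop (𝓝 0) := fun hw => by
    have h := (hsummable hw).tendsto_atTop_zero.sqrt
    simp only [Real.sqrt_sq (norm_nonneg _), Real.sqrt_zero] at h
    exact tendsto_zero_iff_norm_tendsto_zero.2 h
  constructor
  · rintro ⟨P, -, h⟩ u hu hy
    have hlim : Tendsto (fun N => ∑ k ∈ Finset.range N, (a * ‖u k‖ ^ 2 + b * ‖S.output u k‖ ^ 2))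
        atTop (𝓝 (a * ∑' k, ‖u k‖ ^ 2 + b * ∑' k, ‖S.output u k‖ ^ 2)) := by
      rw [← tsum_mul_left, ← tsum_mul_left,
        ← ((hsummable hu).mul_left a).tsum_add ((hsummable hy).mul_left b)]
      exact (((hsummable hu).mul_left a).add ((hsummable hy).mul_left b)).tendsto_sum_tsum_nat
    have hc : Continuous fun x : Fin n → ℝ => x ⬝ᵥ P *ᵥ x := by fun_prop
    have hstore : ∀ φ : ℂ →ₗ[ℝ] ℝ, Tendsto
        (fun N => (φ ∘ S.state u N) ⬝ᵥ P *ᵥ (φ ∘ S.state u N)) atTop (𝓝 0) := fun φ => by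
      simpa [Function.comp_def] using
        (hc.tendsto 0).comp (hS.tendsto_state φ (htendsto hu) (htendsto hy))
    refine le_of_tendsto_of_tendsto' ?_ hlim fun N => h.le_sum u N
    simpa using (hstore Complex.reLm).add (hstore Complex.imLm)
  · intro h
    have hloop : ∀ {N q}, Transfer S.A.mulVecLin S.B.mulVecLin (S.cost a b) N 0 0 q → 0 ≤ q := by
      intro N q hN
      obtain ⟨u, hu, hx, rfl⟩ := exists_signal_of_transfer hN
      -- Once back at the origin with zero input the system rests, so a loop gives finitely
      -- supported input and output, to which `h` applies.
      have hx' : ∀ k, N ≤ k → S.state u k = 0 := by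
        intro k hk
        induction k, hk using Nat.le_induction with
        | base => rw [hx]; ext; simp
        | succ k hk ih => rw [state, ih, hu k hk]; simp
      have hy : ∀ k, N ≤ k → S.output u k = 0 := fun k hk => by
        rw [output, hx' k hk, hu k hk]
        simp
      have hfin : ∀ {w : Signal m}, (∀ k, N ≤ k → w k = 0) → Memℓp w 2 ∧
          ∑' k, ‖w k‖ ^ 2 = ∑ k ∈ Finset.range N, ‖w k‖ ^ 2 := by
        intro w hw
        have hw' : ∀ k ∉ Finset.range N, ‖w k‖ ^ 2 = 0 := fun k hk => by
          rw [hw k (by simpa using hk)]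
          simp
        refine ⟨memℓp_gen ?_, tsum_eq_sum hw'⟩
        exact summable_of_ne_finset_zero (s := Finset.range N) (by simpa using hw')
      have := h u (hfin hu).1 (hfin hy).1
      rwa [(hfin hu).2, (hfin hy).2, Finset.mul_sum, Finset.mul_sum,
        ← Finset.sum_add_distrib] at this
    obtain ⟨N, hN⟩ := exists_reachable_eq_top (A := S.A.mulVecLin) (B := S.B.mulVecLin)
      (S.isQuadraticCost_cost a b) hS.eq_top_of_reachable
    obtain ⟨P, hsymm, hdiss, -⟩ := exists_isDissipative hS (a := a) (b := b) fun x => by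
      -- Any way of reaching `x`, followed by this return, is a loop, so its cost is at least `-c`.
      obtain ⟨c, hc⟩ := exists_transfer_zero (S.isQuadraticCost_cost a b) hN x
      refine ⟨-c, ?_⟩
      rintro q ⟨M, hM⟩
      linarith [hloop (hM.trans hc)]
    exact ⟨P, hsymm, hdiss⟩


/-- Dissipativity as a linear matrix inequality. -/
theorem posSemidef_neg_fromBlocks_iff {P : Matrix (Fin n) (Fin n) ℝ} (hP : P.IsSymm) (a b : ℝ) :
    (-(Matrix.fromBlocks
      (S.Aᵀ * P * S.A - P - b • (S.Cᵀ * S.C)) (S.Aᵀ * P * S.B - b • (S.Cᵀ * S.D))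
      (S.Bᵀ * P * S.A - b • (S.Dᵀ * S.C))
      (S.Bᵀ * P * S.B - b • (S.Dᵀ * S.D) -
        a • (1 : Matrix (Fin m) (Fin m) ℝ)))).PosSemidef ↔ S.IsDissipative P a b := by
  rw [Matrix.posSemidef_iff_dotProduct_mulVec]
  have hherm : ∀ X : Matrix (Fin n ⊕ Fin m) (Fin n ⊕ Fin m) ℝ, X.IsSymm → (-X).IsHermitian := by
    intro X hX
    rw [Matrix.IsHermitian, Matrix.conjTranspose_eq_transpose_of_trivial, Matrix.transpose_neg,
      hX]
  rw [and_iff_right]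
  · have key : ∀ (x : Fin n → ℝ) (u : Fin m → ℝ), star (Sum.elim x u) ⬝ᵥ (-(Matrix.fromBlocks
      (S.Aᵀ * P * S.A - P - b • (S.Cᵀ * S.C)) (S.Aᵀ * P * S.B - b • (S.Cᵀ * S.D))
      (S.Bᵀ * P * S.A - b • (S.Dᵀ * S.C))
      (S.Bᵀ * P * S.B - b • (S.Dᵀ * S.D) -
        a • (1 : Matrix (Fin m) (Fin m) ℝ)))) *ᵥ Sum.elim x u =
        x ⬝ᵥ P *ᵥ x + S.cost a b x u -
          (S.A *ᵥ x + S.B *ᵥ u) ⬝ᵥ P *ᵥ (S.A *ᵥ x + S.B *ᵥ u) := by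
      intro x u
      have hT : ∀ {i j k : ℕ} (X : Matrix (Fin i) (Fin j) ℝ) (Y : Matrix (Fin i) (Fin k) ℝ)
          (v : Fin j → ℝ) (w : Fin k → ℝ), v ⬝ᵥ (Xᵀ * Y) *ᵥ w = (X *ᵥ v) ⬝ᵥ (Y *ᵥ w) := by
        intro i j k X Y v w
        rw [← Matrix.mulVec_mulVec, Matrix.dotProduct_mulVec, Matrix.vecMul_transpose]
      rw [star_trivial, Matrix.neg_mulVec, Matrix.fromBlocks_mulVec, dotProduct_neg,
        sumElim_dotProduct_sumElim]
      simp only [Sum.elim_comp_inl, Sum.elim_comp_inr, Matrix.sub_mulVec, Matrix.smul_mulVec,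
        Matrix.one_mulVec, dotProduct_add, dotProduct_sub, dotProduct_smul, smul_eq_mul,
        Matrix.mul_assoc, hT, cost, Matrix.mulVec_add, add_dotProduct, Matrix.mulVec_mulVec]
      ring
    constructor
    · intro h x u
      have := h (Sum.elim x u)
      rw [key] at this
      linarith
    · intro h v
      rw [← Sum.elim_comp_inl_inr v, key]
      linarith [h (v ∘ Sum.inl) (v ∘ Sum.inr)]
  · refine hherm _ ?_
    rw [Matrix.IsSymm, Matrix.fromBlocks_transpose]
    congr 1 <;> simp [Matrix.transpose_mul, hP.eq, Matrix.mul_assoc]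

theorem maxLMI_iff {P : Matrix (Fin n) (Fin n) ℝ} (hP : P.IsSymm) (γ : ℝ) :
    S.MaxLMI P γ ↔ S.IsDissipative P (γ ^ 2) (-1) := by
  rw [← posSemidef_neg_fromBlocks_iff hP, MaxLMI]
  simp only [neg_smul, one_smul, sub_neg_eq_add]

theorem minLMI_iff {P : Matrix (Fin n) (Fin n) ℝ} (hP : P.IsSymm) (ζ : ℝ) :
    S.MinLMI P ζ ↔ S.IsDissipative P (-ζ ^ 2) 1 := by
  rw [← posSemidef_neg_fromBlocks_iff hP, MinLMI]
  simp only [neg_smul, one_smul, sub_neg_eq_add]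

end LTI

/-! ### Gains as families of quadratic inequalities -/

theorem maxGain_le_iff {H : Type*} [NormedAddCommGroup H] [InnerProductSpace ℂ H]
    (T : H →ₗ.[ℂ] H) (γ : ℝ≥0) :
    maxGain T ≤ γ ↔ ∀ u : T.domain, ‖T u‖ ^ 2 ≤ (γ : ℝ) ^ 2 * ‖(u : H)‖ ^ 2 := by
  rw [maxGain, iSup₂_le_iff]
  refine forall_congr' fun u => ?_
  rw [← mul_pow, pow_le_pow_iff_left₀ (norm_nonneg _) (by positivity) two_ne_zero]
  rcases eq_or_ne u 0 with rfl | hu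
  · simp
  · have hu' : 0 < ‖(u : H)‖ := norm_pos_iff.2 (by simpa using hu)
    simp only [ne_eq, hu, not_false_eq_true, forall_const]
    rw [← ENNReal.ofReal_coe_nnreal, ENNReal.ofReal_le_ofReal_iff γ.coe_nonneg, div_le_iff₀ hu']

theorem le_minGain_iff {H : Type*} [NormedAddCommGroup H] [InnerProductSpace ℂ H]
    (T : H →ₗ.[ℂ] H) (ζ : ℝ≥0) :
    ζ ≤ minGain T ↔ ∀ u : T.domain, (ζ : ℝ) ^ 2 * ‖(u : H)‖ ^ 2 ≤ ‖T u‖ ^ 2 := by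
  rw [minGain, le_iInf₂_iff]
  refine forall_congr' fun u => ?_
  rw [← mul_pow, pow_le_pow_iff_left₀ (by positivity) (norm_nonneg _) two_ne_zero]
  rcases eq_or_ne u 0 with rfl | hu
  · simp
  · have hu' : 0 < ‖(u : H)‖ := norm_pos_iff.2 (by simpa using hu)
    simp only [ne_eq, hu, not_false_eq_true, forall_const]
    rw [← ENNReal.ofReal_coe_nnreal, ENNReal.ofReal_le_ofReal_iff (by positivity),
      le_div_iff₀ hu']

theorem eq_iInf_of_le_iff {x : ℝ≥0∞} {p : ℝ≥0 → Prop} (h : ∀ γ : ℝ≥0, x ≤ γ ↔ p γ) :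
    x = ⨅ (γ : ℝ≥0) (_ : p γ), (γ : ℝ≥0∞) := by
  refine le_antisymm (le_iInf₂ fun γ hγ => (h γ).2 hγ) ?_
  induction x with
  | top => exact le_top
  | coe x => exact iInf₂_le x ((h x).1 le_rfl)

theorem eq_iSup_of_le_iff {x : ℝ≥0∞} {p : ℝ≥0 → Prop} (h : ∀ ζ : ℝ≥0, ζ ≤ x ↔ p ζ) :
    x = ⨆ (ζ : ℝ≥0) (_ : p ζ), (ζ : ℝ≥0∞) := by
  refine le_antisymm (ENNReal.le_of_forall_nnreal_lt fun ζ hζ => ?_)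
    (iSup₂_le fun ζ hζ => (h ζ).2 hζ)
  exact le_iSup₂ (f := fun (ζ : ℝ≥0) (_ : p ζ) => (ζ : ℝ≥0∞)) ζ ((h ζ).1 hζ.le)

theorem EllTwo.norm_sq_eq_tsum {m : ℕ} (u : EllTwo m) : ‖u‖ ^ 2 = ∑' k, ‖u k‖ ^ 2 := by
  simpa using lp.norm_rpow_eq_tsum (p := 2) (by norm_num) u

theorem norm_sq_eq_sum_of_mem_ellTwoTrunc {m τ : ℕ} (u : ellTwoTrunc m τ) :
    ‖u‖ ^ 2 = ∑ k ∈ Finset.range τ, ‖(u : EllTwo m) k‖ ^ 2 := by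
  refine (EllTwo.norm_sq_eq_tsum u.1).trans (tsum_eq_sum fun k hk => ?_)
  rw [u.2 k (by simpa using hk)]
  simp

namespace LTI

variable {n m : ℕ} (S : LTI n m)

/-- By causality the outputs before `τ` see only the inputs before `τ`, so the truncation of the
input can be dropped. -/
theorem forall_opTrunc_iff (τ : ℕ) (p : ℝ → ℝ → Prop) :
    (∀ u : (S.opTrunc τ).domain, p (‖(u : ellTwoTrunc m τ)‖ ^ 2) (‖S.opTrunc τ u‖ ^ 2)) ↔
      ∀ u : Signal m, p (∑ k ∈ Finset.range τ, ‖u k‖ ^ 2)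
        (∑ k ∈ Finset.range τ, ‖S.output u k‖ ^ 2) := by
  have hout : ∀ u : (S.opTrunc τ).domain, ‖S.opTrunc τ u‖ ^ 2 =
      ∑ k ∈ Finset.range τ, ‖S.output (u : ellTwoTrunc m τ).1 k‖ ^ 2 := by
    intro u
    rw [norm_sq_eq_sum_of_mem_ellTwoTrunc]
    refine Finset.sum_congr rfl fun k hk => ?_
    change ‖S.truncOutput τ _ k‖ ^ 2 = _
    rw [truncOutput, if_pos (Finset.mem_range.1 hk)]
    rfl
  constructor
  · intro h u
    let v : Signal m := fun k => if k < τ then u k else 0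
    have hv : Memℓp v 2 := by
      refine memℓp_gen (summable_of_ne_finset_zero (s := Finset.range τ) fun k hk => ?_)
      have hk' : ¬ k < τ := by simpa using hk
      simp [v, hk']
    have hvu : ∀ k < τ, v k = u k := fun k hk => if_pos hk
    have := h ⟨⟨⟨v, hv⟩, fun k hk => if_neg (not_lt.2 hk)⟩, trivial⟩
    rw [hout, norm_sq_eq_sum_of_mem_ellTwoTrunc] at this
    convert this using 1
    · exact Finset.sum_congr rfl fun k hk => by rw [← hvu k (Finset.mem_range.1 hk)]
    · refine Finset.sum_congr rfl fun k hk => ?_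
      have hk := Finset.mem_range.1 hk
      rw [S.output_congr fun j hj => (hvu j (hj.trans_lt hk)).symm]
  · intro h u
    rw [hout, norm_sq_eq_sum_of_mem_ellTwoTrunc]
    exact h _

theorem maxGain_opTrunc_le_iff (τ : ℕ) (γ : ℝ≥0) :
    maxGain (S.opTrunc τ) ≤ γ ↔ ∀ u : Signal m,
      0 ≤ ∑ k ∈ Finset.range τ, ((γ : ℝ) ^ 2 * ‖u k‖ ^ 2 + -1 * ‖S.output u k‖ ^ 2) := by
  rw [maxGain_le_iff, S.forall_opTrunc_iff τ fun x y => y ≤ (γ : ℝ) ^ 2 * x]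
  refine forall_congr' fun u => ?_
  rw [Finset.sum_add_distrib, ← Finset.mul_sum, ← Finset.mul_sum, neg_one_mul, ← sub_eq_add_neg,
    sub_nonneg]

theorem le_minGain_opTrunc_iff (τ : ℕ) (ζ : ℝ≥0) :
    ζ ≤ minGain (S.opTrunc τ) ↔ ∀ u : Signal m,
      0 ≤ ∑ k ∈ Finset.range τ, (-(ζ : ℝ) ^ 2 * ‖u k‖ ^ 2 + 1 * ‖S.output u k‖ ^ 2) := by
  rw [le_minGain_iff, S.forall_opTrunc_iff τ fun x y => (ζ : ℝ) ^ 2 * x ≤ y]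
  refine forall_congr' fun u => ?_
  rw [Finset.sum_add_distrib, ← Finset.mul_sum, ← Finset.mul_sum, one_mul, neg_mul,
    neg_add_eq_sub, sub_nonneg]

theorem sum_delay (a b : ℝ) (u : Signal m) (τ : ℕ) :
    ∑ k ∈ Finset.range (τ + 1), (a * ‖delay u k‖ ^ 2 + b * ‖S.output (delay u) k‖ ^ 2) =
      ∑ k ∈ Finset.range τ, (a * ‖u k‖ ^ 2 + b * ‖S.output u k‖ ^ 2) := by
  simp [Finset.sum_range_succ', output_delay_zero, output_delay_succ, delay]

/-- Delaying an input by one step lengthens the horizon by one without changing the accumulated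
cost. -/
theorem monotone_maxGain_opTrunc : Monotone fun τ => maxGain (S.opTrunc τ) := by
  refine monotone_nat_of_le_succ fun τ => ?_
  generalize hg : maxGain (S.opTrunc (τ + 1)) = g
  induction g with
  | top => exact le_top
  | coe γ =>
    rw [maxGain_opTrunc_le_iff]
    intro u
    rw [← sum_delay]
    exact (S.maxGain_opTrunc_le_iff _ γ).1 hg.le _

theorem antitone_minGain_opTrunc : Antitone fun τ => minGain (S.opTrunc τ) := by
  refine antitone_nat_of_succ_le fun τ => ENNReal.le_of_forall_nnreal_lt fun ζ hζ => ?_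
  rw [le_minGain_opTrunc_iff]
  intro u
  rw [← sum_delay]
  exact (S.le_minGain_opTrunc_iff _ ζ).1 hζ.le _

variable {S}

theorem iSup_maxGain_opTrunc (hS : S.IsMinimal) :
    ⨆ τ, maxGain (S.opTrunc τ) = ⨅ (γ : ℝ≥0)
      (_ : ∃ P : Matrix (Fin n) (Fin n) ℝ, P.IsSymm ∧ P.PosSemidef ∧ S.MaxLMI P γ),
        (γ : ℝ≥0∞) := by
  refine eq_iInf_of_le_iff fun γ => ?_
  rw [iSup_le_iff]
  simp only [maxGain_opTrunc_le_iff]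
  rw [forall_comm, ← exists_posSemidef_isDissipative_iff hS]
  exact exists_congr fun P => and_congr_right fun hP => by rw [maxLMI_iff hP]

theorem iInf_minGain_opTrunc (hS : S.IsMinimal) :
    ⨅ τ, minGain (S.opTrunc τ) = ⨆ (ζ : ℝ≥0)
      (_ : ∃ P : Matrix (Fin n) (Fin n) ℝ, P.IsSymm ∧ P.PosSemidef ∧ S.MinLMI P ζ),
        (ζ : ℝ≥0∞) := by
  refine eq_iSup_of_le_iff fun ζ => ?_
  rw [le_iInf_iff]
  simp only [le_minGain_opTrunc_iff]
  rw [forall_comm, ← exists_posSemidef_isDissipative_iff hS]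
  exact exists_congr fun P => and_congr_right fun hP => by rw [minLMI_iff hP]

variable (S)

theorem forall_opT_iff (p : ℝ → ℝ → Prop) :
    (∀ u : S.opT.domain, p (‖(u : EllTwo m)‖ ^ 2) (‖S.opT u‖ ^ 2)) ↔
      ∀ u : Signal m, Memℓp u 2 → Memℓp (S.output u) 2 →
        p (∑' k, ‖u k‖ ^ 2) (∑' k, ‖S.output u k‖ ^ 2) := by
  constructor
  · intro h u hu hy
    have := h ⟨⟨u, hu⟩, hy⟩
    rwa [EllTwo.norm_sq_eq_tsum, EllTwo.norm_sq_eq_tsum] at this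
  · intro h u
    rw [EllTwo.norm_sq_eq_tsum, EllTwo.norm_sq_eq_tsum]
    exact h u.1 (lp.memℓp u.1) u.2

variable {S}

theorem maxGain_opT (hS : S.IsMinimal) :
    maxGain S.opT = ⨅ (γ : ℝ≥0)
      (_ : ∃ P : Matrix (Fin n) (Fin n) ℝ, P.IsSymm ∧ S.MaxLMI P γ), (γ : ℝ≥0∞) := by
  refine eq_iInf_of_le_iff fun γ => ?_
  rw [maxGain_le_iff, S.forall_opT_iff fun x y => y ≤ (γ : ℝ) ^ 2 * x]
  simp only [← sub_nonneg (b := tsum _), sub_eq_add_neg, ← neg_one_mul (tsum _)]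
  rw [← exists_isDissipative_iff hS]
  exact exists_congr fun P => and_congr_right fun hP => by rw [maxLMI_iff hP]

theorem minGain_opT (hS : S.IsMinimal) :
    minGain S.opT = ⨆ (ζ : ℝ≥0)
      (_ : ∃ P : Matrix (Fin n) (Fin n) ℝ, P.IsSymm ∧ S.MinLMI P ζ), (ζ : ℝ≥0∞) := by
  refine eq_iSup_of_le_iff fun ζ => ?_
  rw [le_minGain_iff, S.forall_opT_iff fun x y => (ζ : ℝ) ^ 2 * x ≤ y]
  have : (∃ P : Matrix (Fin n) (Fin n) ℝ, P.IsSymm ∧ S.MinLMI P ζ) ↔ _ :=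
    (exists_congr fun P => and_congr_right fun hP => by rw [minLMI_iff hP]).trans
      (exists_isDissipative_iff hS (a := -(ζ : ℝ) ^ 2) (b := 1))
  rw [this]
  refine forall₃_congr fun u _ _ => ?_
  rw [one_mul, neg_mul, neg_add_eq_sub, sub_nonneg]

end LTI

end GainLMI

theorem theorem1 {n m : ℕ} (S : GainLMI.LTI n m) (hS : S.IsMinimal) :
    Tendsto (fun τ : ℕ => GainLMI.maxGain (S.opTrunc τ)) atTop
      (𝓝 (⨅ (γ : ℝ≥0)
        (_ : ∃ P : Matrix (Fin n) (Fin n) ℝ, P.IsSymm ∧ P.PosSemidef ∧ S.MaxLMI P γ),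
          (γ : ℝ≥0∞))) ∧
    Tendsto (fun τ : ℕ => GainLMI.minGain (S.opTrunc τ)) atTop
      (𝓝 (⨆ (ζ : ℝ≥0)
        (_ : ∃ P : Matrix (Fin n) (Fin n) ℝ, P.IsSymm ∧ P.PosSemidef ∧ S.MinLMI P ζ),
          (ζ : ℝ≥0∞))) ∧
    GainLMI.maxGain S.opT =
      (⨅ (γ : ℝ≥0)
        (_ : ∃ P : Matrix (Fin n) (Fin n) ℝ, P.IsSymm ∧ S.MaxLMI P γ), (γ : ℝ≥0∞)) ∧
    GainLMI.minGain S.opT =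
      (⨆ (ζ : ℝ≥0)
        (_ : ∃ P : Matrix (Fin n) (Fin n) ℝ, P.IsSymm ∧ S.MinLMI P ζ), (ζ : ℝ≥0∞)) := by
  refine ⟨?_, ?_, GainLMI.LTI.maxGain_opT hS, GainLMI.LTI.minGain_opT hS⟩
  · rw [← GainLMI.LTI.iSup_maxGain_opTrunc hS]
    exact tendsto_atTop_iSup S.monotone_maxGain_opTrunc
  · rw [← GainLMI.LTI.iInf_minGain_opTrunc hS]
    exact tendsto_atTop_iInf S.antitone_minGain_opTrunc
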